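/- For a nonempty set $X$ let $\mathcal T_X$ be the full transformation semigroup over $X$, that is, the semigroup of all maps $X\to X$ under composition (maps are written on the right, so $fg$ means first $f$, then $g$), and write $\mathcal T_n=\mathcal T_{\{1,\dots,n\}}$. The rank of $f\in\mathcal T_n$ is the size of its image. The (minimum transformation) degree of a semigroup $S$ is $$\mu(S)=\min\{|X| : X\neq\varnothing,\ S\text{ embeds in }\mathcal T_X\},$$ where an embedding is an injective semigroup homomorphism. For $a\in\mathcal T_n$, the variant $\mathcal T_n^a$ is the semigroup with underlying set $\mathcal T_n$ and operation $f\star g=fag$. Theorem. Let $n\geq 1$ be an integer and let $a\in\mathcal T_n$ have rank $r\geq n-6$. Then $\mu(\mathcal T_n^a)=2n-r$. -/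

import Mathlib

/-- The full transformation semigroup `𝒯_X`: all self-maps of `X`. -/
def FullTransformation (X : Type*) : Type _ := X → X

namespace FullTransformation

/-- Maps act on the right, so `f * g` means "first `f`, then `g`". -/
instance instSemigroup (X : Type*) : Semigroup (FullTransformation X) where
  mul f g := fun x => g (f x)
  mul_assoc _ _ _ := rfl

theorem mul_apply {X : Type*} (f g : FullTransformation X) (x : X) :
    (f * g) x = g (f x) := rfl

/-- The rank of a transformation of a finite set: the size of its image. -/
noncomputable def rank {X : Type*} [Finite X] (f : FullTransformation X) : ℕ :=
  (Set.range f).ncard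

end FullTransformation

/-- The underlying set of the variant `S^a` of a semigroup `S`. -/
def SemigroupVariant {S : Type*} [Semigroup S] (_a : S) : Type _ := S

namespace SemigroupVariant

/-- The sandwich operation `x ⋆ y = x a y`, where the products on the right are taken in `S`. -/
def sandwich {S : Type*} [Semigroup S] (a x y : S) : S := x * a * y

theorem sandwich_assoc {S : Type*} [Semigroup S] (a x y z : S) :
    sandwich a (sandwich a x y) z = sandwich a x (sandwich a y z) := by
  simp only [sandwich, mul_assoc]

instance instSemigroup {S : Type*} [Semigroup S] (a : S) : Semigroup (SemigroupVariant a) where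
  mul x y := sandwich (S := S) a x y
  mul_assoc x y z := sandwich_assoc (S := S) a x y z

theorem mul_def {S : Type*} [Semigroup S] (a : S) (x y : SemigroupVariant a) :
    x * y = sandwich (S := S) a x y := rfl

end SemigroupVariant

/-- A semigroup `S` embeds in a semigroup `T`: there is an injective homomorphism `S → T`. -/
def SemigroupEmbeds (S T : Type*) [Semigroup S] [Semigroup T] : Prop :=
  ∃ φ : S →ₙ* T, Function.Injective φ

universe u

/-- The cardinalities `|X|` of the nonempty sets `X` such that `S` embeds in `𝒯_X`. -/
def transformationDegrees (S : Type u) [Semigroup S] : Set Cardinal.{u} :=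
  {c | ∃ X : Type u, Nonempty X ∧ SemigroupEmbeds S (FullTransformation X) ∧ Cardinal.mk X = c}

/-- The minimum transformation degree `μ(S) = min {|X| : X ≠ ∅, S embeds in 𝒯_X}`.
It is a minimum: see `minTransformationDegree_isLeast`. -/
noncomputable def minTransformationDegree (S : Type u) [Semigroup S] : Cardinal.{u} :=
  sInf (transformationDegrees S)

/-- Cayley's theorem: `S` embeds in the full transformation semigroup over `S` with an
identity adjoined. -/
theorem transformationDegrees_nonempty (S : Type u) [Semigroup S] :
    (transformationDegrees S).Nonempty := by
  refine ⟨_, WithOne S, ⟨1⟩, ⟨⟨fun s => fun x => x * (s : WithOne S), ?_⟩, ?_⟩, rfl⟩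
  · intro s t
    funext x
    change x * ((s * t : S) : WithOne S) = x * (s : WithOne S) * (t : WithOne S)
    rw [WithOne.coe_mul, mul_assoc]
  · intro s t h
    have h1 : (1 : WithOne S) * (s : WithOne S) = 1 * (t : WithOne S) := congrFun h 1
    rw [one_mul, one_mul] at h1
    exact WithOne.coe_inj.mp h1

theorem minTransformationDegree_isLeast (S : Type u) [Semigroup S] :
    IsLeast (transformationDegrees S) (minTransformationDegree S) :=
  ⟨csInf_mem (transformationDegrees_nonempty S), fun _ hc => csInf_le' hc⟩

/-! Put k = n - r. Upper bound (`extend`): adjoin to the n points one point for each of the k points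
missed by `a`, from which the remaining values of f can be read. Lower bound: let φ be a faithful
action on Y, with q points of Y never hit. Maps that agree after applying `a` send each point to
inseparable hit points, so counting such maps bounds the sizes of inseparability classes. Along a
chain of idempotents, adjoining a point j with fibre size t_j ≤ 5 adds classes of total size at
least t_j (`add_sum_card_fiber_le`). For a largest fibre, of size t, varying a map on the missed
points gives t^k ≤ M^q for some class size M (`exists_pow_le`). For k ≤ 6 this forces t + k ≤ M + q,
whence |Y| ≥ n + k, except when t = 2, k = 6, M + q = 7. There a second two-point fibre supplies the
missing unit. -/

namespace FullTransformation

/-! ### Lower bound: inseparability classes -/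

section Representation

variable {Z Y : Type} {a : Z → Z} {φ : (Z → Z) → Y → Y}

/-- `φ` represents the variant `𝒯_Z^a` by transformations of `Y`. -/
def IsVariantRep (a : Z → Z) (φ : (Z → Z) → Y → Y) : Prop :=
  ∀ f g y, φ (fun x => g (a (f x))) y = φ g (φ f y)

theorem IsVariantRep.comp (h : IsVariantRep a φ) {f g e : Z → Z}
    (he : ∀ x, g (a (f x)) = e x) (y : Y) : φ g (φ f y) = φ e y := by
  rw [← h, show (fun x => g (a (f x))) = e from funext he]

/-- The points moved identically by all transformations of the representation. -/
def Inseparable (φ : (Z → Z) → Y → Y) (y y' : Y) : Prop := ∀ f, φ f y = φ f y'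

theorem IsVariantRep.inseparable (h : IsVariantRep a φ) {f g : Z → Z}
    (hfg : ∀ x, a (f x) = a (g x)) (y : Y) : Inseparable φ (φ f y) (φ g y) := fun e => by
  rw [← h, ← h]; simp only [hfg]

open Classical in
/-- The points hit by some transformation of the representation. -/
noncomputable def hit [Fintype Y] (φ : (Z → Z) → Y → Y) : Finset Y :=
  {y | ∃ f y', φ f y' = y}

open Classical in
/-- The hit points that are inseparable from `y`. -/
noncomputable def hitClass [Fintype Y] (φ : (Z → Z) → Y → Y) (y : Y) : Finset Y :=
  {y' ∈ hit φ | Inseparable φ y y'}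

open Classical in
/-- The map that sends `U` to its lifts under the section `s`, and all other points to the
lift of `i`. -/
noncomputable def retraction (s : Z → Z) (i : Z) (U : Finset Z) : Z → Z :=
  fun w => s (if w ∈ U then w else i)

open Classical in
/-- The image of a transformation. -/
noncomputable def imagePoints [Fintype Y] (φ : (Z → Z) → Y → Y) (f : Z → Z) : Finset Y :=
  Finset.univ.image (φ f)

variable [Fintype Y]

theorem mem_hit (f : Z → Z) (y : Y) : φ f y ∈ hit φ := by
  simp only [hit, Finset.mem_filter, Finset.mem_univ, true_and]; exact ⟨f, y, rfl⟩

theorem mem_imagePoints {f : Z → Z} {y : Y} : y ∈ imagePoints φ f ↔ ∃ x, φ f x = y := by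
  simp [imagePoints]

theorem mem_hitClass {y y' : Y} : y' ∈ hitClass φ y ↔ y' ∈ hit φ ∧ Inseparable φ y y' := by
  simp [hitClass]

theorem hitClass_card_pos {y : Y} (hy : y ∈ hit φ) : 1 ≤ (hitClass φ y).card :=
  Finset.card_pos.mpr ⟨y, mem_hitClass.mpr ⟨hy, fun _ => rfl⟩⟩

theorem imagePoints_subset_hit (f : Z → Z) : imagePoints φ f ⊆ hit φ := fun y hy => by
  obtain ⟨x, rfl⟩ := mem_imagePoints.mp hy
  exact mem_hit f x

theorem IsVariantRep.fixed (h : IsVariantRep a φ) {f g : Z → Z} (hfg : ∀ x, g (a (f x)) = f x)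
    {y : Y} (hy : y ∈ imagePoints φ f) : φ g y = y := by
  obtain ⟨x, rfl⟩ := mem_imagePoints.mp hy
  exact h.comp hfg x

theorem IsVariantRep.imagePoints_subset (h : IsVariantRep a φ) {f g : Z → Z}
    (hfg : ∀ x, g (a (f x)) = f x) : imagePoints φ f ⊆ imagePoints φ g := fun y hy =>
  mem_imagePoints.mpr ⟨y, h.fixed hfg hy⟩

/-- An idempotent fixes its image points, hence separates them, so their classes are disjoint. -/
theorem IsVariantRep.sum_hitClass_le (h : IsVariantRep a φ) {f : Z → Z}
    (hf : ∀ x, f (a (f x)) = f x) :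
    ∑ y ∈ imagePoints φ f, (hitClass φ y).card ≤ (hit φ).card := by
  classical
  rw [← Finset.card_biUnion]
  · apply Finset.card_le_card
    intro y hy
    obtain ⟨x, -, hx⟩ := Finset.mem_biUnion.mp hy
    exact (mem_hitClass.mp hx).1
  · intro x hx y hy hxy
    refine Finset.disjoint_left.mpr fun w hw hw' => hxy ?_
    rw [← h.fixed hf hx, ← h.fixed hf hy, (mem_hitClass.mp hw).2, (mem_hitClass.mp hw').2]

open Classical in
/-- Transformations that are inseparable pointwise are counted by their values where they
differ. -/
theorem card_le_prod_hitClass {ι : Type*} (F : Finset ι) (g : ι → Z → Z) (e : Z → Z)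
    (J : Finset Y) (hsep : ∀ z ∈ F, ∀ y, Inseparable φ (φ e y) (φ (g z) y))
    (hJ : ∀ z ∈ F, ∀ z' ∈ F, (∀ y ∈ J, φ (g z) y = φ (g z') y) → z = z') :
    F.card ≤ ∏ y ∈ J, (hitClass φ (φ e y)).card := by
  rw [← Finset.card_pi]
  refine Finset.card_le_card_of_injOn (fun z y _ => φ (g z) y) ?_ ?_
  · intro z hz
    simp only [Finset.mem_coe, Finset.mem_pi]
    intro y _
    exact mem_hitClass.mpr ⟨mem_hit _ _, hsep z hz y⟩
  · intro z hz z' hz' hzz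
    exact hJ z hz z' hz' fun y hy => congrFun (congrFun hzz y) hy

/-! ### Chains of idempotents -/

variable {s : Z → Z} {i : Z}

theorem retraction_of_mem {U : Finset Z} {w : Z} (hw : w ∈ U) : retraction s i U w = s w := by
  simp [retraction, hw]

theorem retraction_of_notMem {U : Finset Z} {w : Z} (hw : w ∉ U) :
    retraction s i U w = s i := by
  simp [retraction, hw]

theorem section_apply_retraction {U : Finset Z} (hs : ∀ w ∈ U, a (s w) = w) (hi : i ∈ U) (w : Z) :
    a (retraction s i U w) ∈ U ∧ s (a (retraction s i U w)) = retraction s i U w := by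
  by_cases hw : w ∈ U
  · rw [retraction_of_mem hw, hs w hw]; exact ⟨hw, rfl⟩
  · rw [retraction_of_notMem hw, hs i hi]; exact ⟨hi, rfl⟩

theorem retraction_comp {U V : Finset Z} (hs : ∀ w ∈ U, a (s w) = w) (hi : i ∈ U) (hUV : U ⊆ V)
    (w : Z) : retraction s i V (a (retraction s i U w)) = retraction s i U w := by
  obtain ⟨h1, h2⟩ := section_apply_retraction (a := a) hs hi w
  rw [retraction_of_mem (hUV h1), h2]

-- Redirecting the value of the larger idempotent at j within the fibre over j gives maps that fix
-- the old image points and move each new one within its class. They are determined by their action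
-- on the new points.
open Classical in
theorem IsVariantRep.card_fiber_le_prod [Fintype Z] (h : IsVariantRep a φ)
    (hφ : Function.Injective φ)
    {U : Finset Z} {j : Z} (hs : ∀ w ∈ insert j U, a (s w) = w) (hi : i ∈ U) (hj : j ∉ U) :
    (Finset.univ.filter (fun z => a z = j)).card ≤
      ∏ y ∈ imagePoints φ (retraction s i (insert j U)) \ imagePoints φ (retraction s i U),
        (hitClass φ y).card := by
  have hsU : ∀ w ∈ U, a (s w) = w := fun w hw => hs w (Finset.mem_insert_of_mem hw)
  set e := retraction s i (insert j U) with he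
  have hee : ∀ x, e (a (e x)) = e x :=
    retraction_comp hs (Finset.mem_insert_of_mem hi) (Finset.Subset.refl _)
  have hej : a (e j) = j := by
    rw [he, retraction_of_mem (Finset.mem_insert_self _ _), hs j (Finset.mem_insert_self _ _)]
  have hae : ∀ w, w ≠ j → a (e w) ≠ j := by
    intro w hw
    by_cases hwU : w ∈ U
    · rw [he, retraction_of_mem (Finset.mem_insert_of_mem hwU), hsU w hwU]; exact hw
    · rw [he, retraction_of_notMem (by simp [hw, hwU]), hsU i hi]
      rintro rfl; exact hj hi
  refine (card_le_prod_hitClass (φ := φ) _ (fun z => Function.update e j z) e _ ?_ ?_).trans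
    (Finset.prod_le_prod' fun y hy => ?_)
  · intro z hz y
    apply h.inseparable
    intro x
    rcases eq_or_ne x j with rfl | hx
    · rw [Function.update_self, hej, (Finset.mem_filter.mp hz).2]
    · rw [Function.update_of_ne hx]
  · intro z _ z' _ hzz
    have key : ∀ y ∈ imagePoints φ e, φ (Function.update e j z) y = φ (Function.update e j z') y := by
      intro y hy
      by_cases hyU : y ∈ imagePoints φ (retraction s i U)
      · have hfix : ∀ z, φ (Function.update e j z) y = y := fun z => by
          refine h.fixed (fun x => ?_) hyU
          have hx := (section_apply_retraction (a := a) (i := i) hsU hi x).1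
          rw [Function.update_of_ne (ne_of_mem_of_not_mem hx hj)]
          exact retraction_comp hsU hi (Finset.subset_insert _ _) x
        rw [hfix, hfix]
      · exact hzz y (Finset.mem_sdiff.mpr ⟨hy, hyU⟩)
    have hcomp : ∀ z x, Function.update e j z (a (e x)) = Function.update e j z x := by
      intro z x
      rcases eq_or_ne x j with rfl | hx
      · rw [hej]
      · rw [Function.update_of_ne hx, Function.update_of_ne (hae x hx), hee]
    have : Function.update e j z = Function.update e j z' := by
      apply hφ
      funext y
      rw [← h.comp (hcomp z) y, ← h.comp (hcomp z') y]
      exact key _ (mem_imagePoints.mpr ⟨y, rfl⟩)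
    simpa using congrFun this j
  · rw [h.fixed hee (Finset.mem_sdiff.mp hy).1]

-- Excludes the empty product 1 against the empty sum 0 when passing from products to sums.
open Classical in
theorem IsVariantRep.imagePoints_sdiff_nonempty (h : IsVariantRep a φ)
    (hφ : Function.Injective φ)
    {U : Finset Z} {j : Z} (hs : ∀ w ∈ insert j U, a (s w) = w) (hi : i ∈ U) (hj : j ∉ U) :
    (imagePoints φ (retraction s i (insert j U)) \
      imagePoints φ (retraction s i U)).Nonempty := by
  have hsU : ∀ w ∈ U, a (s w) = w := fun w hw => hs w (Finset.mem_insert_of_mem hw)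
  by_contra hne
  rw [Finset.not_nonempty_iff_eq_empty, Finset.sdiff_eq_empty_iff_subset] at hne
  have : retraction s i (insert j U) = retraction s i U := by
    apply hφ
    funext y
    have hy := h.fixed (retraction_comp hsU hi (Finset.Subset.refl U))
      (hne (mem_imagePoints.mpr ⟨y, rfl⟩))
    rw [← hy]
    apply h.comp
    intro x
    by_cases hx : x ∈ insert j U
    · rw [retraction_of_mem hx, hs x hx]
    · rw [retraction_of_notMem hx, hsU i hi, retraction_of_mem hi,
        retraction_of_notMem (fun hxU => hx (Finset.mem_insert_of_mem hxU))]
  have hji := congrArg a (congrFun this j)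
  rw [retraction_of_mem (Finset.mem_insert_self _ _), retraction_of_notMem hj,
    hs j (Finset.mem_insert_self _ _), hsU i hi] at hji
  exact hj (hji ▸ hi)

/-- The bound 4 is sharp, since 2 * 3 > 2 + 3; this is why fibres of size at most 5 can be handled.
-/
theorem prod_le_sum_of_sum_le_four {ι : Type*} (c : ι → ℕ) {J : Finset ι} (hJ : J.Nonempty)
    (hc : ∀ y ∈ J, 1 ≤ c y) (hsum : ∑ y ∈ J, c y ≤ 4) : ∏ y ∈ J, c y ≤ ∑ y ∈ J, c y := by
  induction hJ using Finset.Nonempty.cons_induction with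
  | singleton x => simp
  | cons x J hx hJ ih =>
    rw [Finset.prod_cons, Finset.sum_cons]
    rw [Finset.sum_cons] at hsum
    have h1 := hc x (Finset.mem_cons_self x J)
    have hcJ : ∀ y ∈ J, 1 ≤ c y := fun y hy => hc y (Finset.mem_cons_of_mem hy)
    have h2 := ih hcJ (by omega)
    have h3 : 1 ≤ ∑ y ∈ J, c y := by
      obtain ⟨y, hy⟩ := hJ
      exact (hcJ y hy).trans (Finset.single_le_sum (fun _ _ => Nat.zero_le _) hy)
    refine (Nat.mul_le_mul_left _ h2).trans ?_
    generalize ∑ y ∈ J, c y = S at *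
    have : c x ≤ 3 := by omega
    interval_cases c x <;> omega

open Classical in
theorem IsVariantRep.add_sum_card_fiber_le [Fintype Z] (h : IsVariantRep a φ)
    (hφ : Function.Injective φ) {U : Finset Z} (hi : i ∈ U) (W : Finset Z) (hUW : Disjoint U W)
    (hs : ∀ w ∈ U ∪ W, a (s w) = w)
    (hW : ∀ w ∈ W, (Finset.univ.filter (fun z => a z = w)).card ≤ 5) :
    ∑ y ∈ imagePoints φ (retraction s i U), (hitClass φ y).card +
        ∑ w ∈ W, (Finset.univ.filter (fun z => a z = w)).card ≤
      ∑ y ∈ imagePoints φ (retraction s i (U ∪ W)), (hitClass φ y).card := by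
  induction W using Finset.induction_on with
  | empty => simp
  | insert j W hj ih =>
    have hjU : j ∉ U := fun hjU => Finset.disjoint_left.mp hUW hjU (Finset.mem_insert_self _ _)
    have ih := ih (hUW.mono_right (Finset.subset_insert _ _))
      (fun w hw => hs w (Finset.union_subset_union_right (Finset.subset_insert _ _) hw))
      (fun w hw => hW w (Finset.mem_insert_of_mem hw))
    rw [Finset.union_insert] at hs ⊢
    have hiV : i ∈ U ∪ W := Finset.mem_union_left _ hi
    have hjV : j ∉ U ∪ W := by simp [hjU, hj]
    have hsub : imagePoints φ (retraction s i (U ∪ W)) ⊆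
        imagePoints φ (retraction s i (insert j (U ∪ W))) :=
      h.imagePoints_subset (retraction_comp
        (fun w hw => hs w (Finset.mem_insert_of_mem hw)) hiV (Finset.subset_insert _ _))
    rw [Finset.sum_insert hj, ← Finset.sum_sdiff hsub]
    have hprod := h.card_fiber_le_prod hφ hs hiV hjV
    have hpos := prod_le_sum_of_sum_le_four (fun y => (hitClass φ y).card)
      (h.imagePoints_sdiff_nonempty hφ hs hiV hjV)
      (fun y hy => hitClass_card_pos (imagePoints_subset_hit _ (Finset.mem_sdiff.mp hy).1))
    have h5 := hW j (Finset.mem_insert_self _ _)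
    -- If the new classes total less than t_j ≤ 5, their sum is at most 4, so t_j ≤ product ≤ sum <
    -- t_j.
    by_contra hlt
    have := hprod.trans (hpos (by omega))
    omega

open Classical in
/-- Maps into the fiber over `i` are separated by few points, so that one of the classes met by
the constant map is large. -/
theorem IsVariantRep.exists_pow_le [Fintype Z] [Nonempty Y] (h : IsVariantRep a φ)
    (hφ : Function.Injective φ) {z : Z} (hz : a z = i) :
    ∃ y ∈ imagePoints φ (fun _ => z), (Finset.univ.filter (fun z => a z = i)).card ^
      (Finset.univ.filter (fun x => x ∉ Finset.univ.image a)).card ≤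
      (hitClass φ y).card ^ (Finset.univ \ hit φ).card := by
  set F := Finset.univ.filter (fun z => a z = i) with hF
  set N := Finset.univ.filter (fun x => x ∉ Finset.univ.image a) with hN
  have hne : (imagePoints φ (fun _ => z)).Nonempty :=
    ⟨_, mem_imagePoints.mpr ⟨Classical.arbitrary Y, rfl⟩⟩
  obtain ⟨y, hy, hmax⟩ := Finset.exists_max_image _ (fun y => (hitClass φ y).card) hne
  refine ⟨y, hy, ?_⟩
  have hcard : (N.pi fun _ => F).card = F.card ^ N.card := by simp
  rw [← hcard]
  -- Arbitrary in the fibre on points missed by `a`, constant elsewhere. A product f ⋆ g never sees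
  -- the missed points, so these maps agree on all hit points.
  set g : (∀ x ∈ N, Z) → Z → Z := fun p x => if hx : x ∈ N then p x hx else z with hg
  refine (card_le_prod_hitClass (φ := φ) (N.pi fun _ => F) g
    (fun _ => z) (Finset.univ \ hit φ) ?_ ?_).trans
    ((Finset.prod_le_prod' fun x _ => hmax _ (mem_imagePoints.mpr ⟨x, rfl⟩)).trans ?_)
  · intro p hp y
    apply h.inseparable
    intro x
    by_cases hx : x ∈ N
    · have := Finset.mem_pi.mp hp x hx
      simp only [hg, dif_pos hx, hz, (Finset.mem_filter.mp this).2]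
    · simp only [hg, dif_neg hx]
  · intro p _ p' _ hpp
    have hgg : g p = g p' := by
      apply hφ
      funext y
      by_cases hy : y ∈ hit φ
      · obtain ⟨f, x, rfl⟩ : ∃ f x, φ f x = y := by simpa [hit] using hy
        have haN : ∀ w, a w ∉ N := fun w => by simp [hN]
        have : ∀ p : ∀ x ∈ N, Z, φ (g p) (φ f x) = φ (fun _ => z) x := fun p =>
          h.comp (fun w => by simp only [hg, dif_neg (haN _)]) x
        rw [this, this]
      · exact hpp y (by simpa using hy)
    funext x hx
    have := congrFun hgg x
    simpa only [hg, dif_pos hx] using this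
  · rw [Finset.prod_const]

/-! ### Numerical estimates -/

/-- A finite check at the largest M violating the claim. The exception is real: 2^6 ≤ 3^4 and 2^6 =
4^3. -/
theorem lt_add_of_pow_le (k t M q : ℕ) (hk : k ≤ 6) (htk : t ≤ k + 1) (hM : 1 ≤ M) (ht : 1 ≤ t)
    (ht1 : t = 1 → k = 0) (hpow : t ^ k ≤ M ^ q) :
    t + k ≤ M + q ∨ (t = 2 ∧ k = 6 ∧ M + q = 7) := by
  by_contra hcon
  have hfin : ∀ (k : Fin 7) (t : Fin 8) (q : Fin 13),
      1 ≤ t.val → (t.val = 1 → k.val = 0) → t.val ≤ k + 1 → q.val + 2 ≤ t + k →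
      (¬ (t.val = 2 ∧ k.val = 6) → (t + k - 1 - q : ℕ) ^ q.val < t.val ^ k.val) ∧
      (t.val = 2 ∧ k.val = 6 → (t + k - 2 - q : ℕ) ^ q.val < t.val ^ k.val) := by decide +kernel
  have := hfin ⟨k, by omega⟩ ⟨t, by omega⟩ ⟨q, by omega⟩ ht ht1 htk (by simp only; omega)
  simp only at this
  by_cases hexc : t = 2 ∧ k = 6
  · have h2 := this.2 hexc
    have h3 : M ^ q ≤ (t + k - 2 - q) ^ q := Nat.pow_le_pow_left (by omega) q
    omega
  · have h2 := this.1 hexc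
    have h3 : M ^ q ≤ (t + k - 1 - q) ^ q := Nat.pow_le_pow_left (by omega) q
    omega

theorem ten_le_add_of_pow_le {M M' q : ℕ} (h7 : M + q = 7) (hM : 2 ^ 6 ≤ M ^ q)
    (hM' : 2 ^ 6 ≤ M' ^ q) : 10 ≤ M + M' + q := by
  by_contra hcon
  have h2 : M' ^ q ≤ 2 ^ q := Nat.pow_le_pow_left (by omega) q
  have h6 : 6 ≤ q := (Nat.pow_le_pow_iff_right (by norm_num)).mp (hM'.trans h2)
  have : M ≤ 1 := by omega
  have : M ^ q ≤ 1 ^ q := Nat.pow_le_pow_left this q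
  simp at this
  omega

/-! ### The lower bound -/

open Classical in
theorem IsVariantRep.two_mul_card_sub_le [Fintype Z] [Nonempty Z] [Nonempty Y]
    (h : IsVariantRep a φ) (hφ : Function.Injective φ)
    (hk : Fintype.card Z ≤ (Finset.univ.image a).card + 6) :
    2 * Fintype.card Z ≤ (Finset.univ.image a).card + Fintype.card Y := by
  set R := Finset.univ.image a with hR
  set N := Finset.univ.filter (fun x => x ∉ R) with hN
  set t : Z → ℕ := fun i => (Finset.univ.filter (fun z => a z = i)).card with ht
  have hRN : R.card + N.card = Fintype.card Z := by
    have := Finset.card_filter_add_card_filter_not (s := (Finset.univ : Finset Z)) (fun x => x ∈ R)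
    simpa [hN] using this
  have htR : ∑ i ∈ R, t i = Fintype.card Z :=
    (Finset.card_eq_sum_card_image a Finset.univ).symm
  obtain ⟨s, hs⟩ : ∃ s : Z → Z, ∀ w ∈ R, a (s w) = w := by
    refine ⟨fun w => if hw : ∃ z, a z = w then hw.choose else w, fun w hw => ?_⟩
    have hw' : ∃ z, a z = w := by simpa [hR] using hw
    simp only [dif_pos hw']
    exact hw'.choose_spec
  have ht1 : ∀ i ∈ R, 1 ≤ t i := fun i hi =>
    Finset.card_pos.mpr ⟨s i, Finset.mem_filter.mpr ⟨Finset.mem_univ _, hs i hi⟩⟩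
  have hexcess : ∑ i ∈ R, (t i - 1) = N.card := by
    have : ∑ i ∈ R, (t i - 1) + ∑ i ∈ R, 1 = ∑ i ∈ R, t i := by
      rw [← Finset.sum_add_distrib]
      exact Finset.sum_congr rfl fun i hi => Nat.sub_add_cancel (ht1 i hi)
    rw [Finset.sum_const, smul_eq_mul, mul_one] at this
    omega
  have hRne : R.Nonempty := Finset.univ_nonempty.image a
  obtain ⟨i, hi, hmax⟩ := Finset.exists_max_image R t hRne
  have hsplit : ∀ j ∈ R, j ≠ i → t i + t j ≤ N.card + 2 := by
    intro j hj hji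
    have : ∑ w ∈ {i, j}, (t w - 1) ≤ ∑ w ∈ R, (t w - 1) :=
      Finset.sum_le_sum_of_subset (by
        intro w hw; rcases Finset.mem_insert.mp hw with rfl | hw
        · exact hi
        · rwa [Finset.mem_singleton.mp hw])
    rw [Finset.sum_pair (Ne.symm hji)] at this
    have := ht1 i hi
    have := ht1 j hj
    omega
  have hti : t i ≤ N.card + 1 := by
    have : t i - 1 ≤ ∑ w ∈ R, (t w - 1) :=
      Finset.single_le_sum (f := fun w => t w - 1) (fun _ _ => Nat.zero_le _) hi
    omega
  have hone : t i = 1 → N.card = 0 := fun h1 => by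
    rw [← hexcess]
    exact Finset.sum_eq_zero fun w hw => by have := hmax w hw; omega
  -- The two fibre sizes sum to at most k + 2 ≤ 8 and i has the larger, so only the fibre over i can
  -- exceed 5.
  have hsmall : ∀ j ∈ R, j ≠ i → t j ≤ 5 := fun j hj hji => by
    have := hsplit j hj hji
    have := hmax j hj
    omega
  have hA : ∀ U ⊆ R, i ∈ U → ∑ y ∈ imagePoints φ (retraction s i U), (hitClass φ y).card +
      ∑ w ∈ R \ U, t w ≤ (hit φ).card := by
    intro U hU hiU
    have := h.add_sum_card_fiber_le hφ (s := s) hiU (R \ U) Finset.disjoint_sdiff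
      (by rw [Finset.union_sdiff_of_subset hU]; exact hs)
      (fun w hw => hsmall w (Finset.mem_sdiff.mp hw).1
        fun hwi => (Finset.mem_sdiff.mp hw).2 (hwi ▸ hiU))
    rw [Finset.union_sdiff_of_subset hU] at this
    exact this.trans (h.sum_hitClass_le (retraction_comp hs hi (Finset.Subset.refl _)))
  have hq : (Finset.univ \ hit φ).card + (hit φ).card = Fintype.card Y :=
    Finset.card_sdiff_add_card_eq_card (Finset.subset_univ _)
  have hsing : retraction s i {i} = fun _ => s i := by
    funext w
    by_cases hw : w ∈ ({i} : Finset Z)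
    · rw [retraction_of_mem hw, Finset.mem_singleton.mp hw]
    · rw [retraction_of_notMem hw]
  obtain ⟨y, hy, hpow⟩ := h.exists_pow_le hφ (hs i hi)
  have hyH := imagePoints_subset_hit _ hy
  have hA1 := hA {i} (Finset.singleton_subset_iff.mpr hi) (Finset.mem_singleton_self i)
  rw [hsing] at hA1
  have hsum1 : t i + ∑ w ∈ R \ {i}, t w = Fintype.card Z := by
    rw [← htR, ← Finset.sum_sdiff (Finset.singleton_subset_iff.mpr hi), Finset.sum_singleton,
      add_comm]
  have hyle : (hitClass φ y).card ≤
      ∑ y ∈ imagePoints φ (fun _ => s i), (hitClass φ y).card :=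
    Finset.single_le_sum (f := fun y => (hitClass φ y).card) (fun _ _ => Nat.zero_le _) hy
  rcases lt_add_of_pow_le N.card (t i) _ _ (by omega) hti (hitClass_card_pos hyH) (ht1 i hi) hone hpow
    with hgood | ⟨hti2, hN6, h7⟩
  · omega
  -- Fibres now have size at most 2 but total excess 6, so another two-point fibre exists.
  obtain ⟨j, hj, hji, htj⟩ : ∃ j ∈ R, j ≠ i ∧ t j = 2 := by
    by_contra hno
    push Not at hno
    have : ∑ w ∈ R, (t w - 1) = t i - 1 :=
      Finset.sum_eq_single_of_mem i hi fun w hw hwi => by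
        have := hno w hw hwi
        have := hmax w hw
        omega
    omega
  obtain ⟨y', hy', hpow'⟩ := h.exists_pow_le hφ (hs j hj)
  rw [show (Finset.univ.filter (fun z => a z = i)).card = 2 from hti2, hN6] at hpow
  rw [show (Finset.univ.filter (fun z => a z = j)).card = 2 from htj, hN6] at hpow'
  have hyH' := imagePoints_subset_hit _ hy'
  by_cases hyy : y = y'
  · subst hyy
    -- If y were the only image point, the constants at `s i` and `s j` would act alike. A second
    -- class adds the missing unit.
    obtain ⟨x, hx, hxy⟩ : ∃ x ∈ imagePoints φ (fun _ => s i), x ≠ y := by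
      by_contra hno
      push Not at hno
      have : (fun _ : Z => s i) = fun _ => s j := by
        apply hφ
        funext x
        rw [hno _ (mem_imagePoints.mpr ⟨x, rfl⟩),
          ← h.comp (f := fun _ => s i) (g := fun _ => s j) (fun _ => rfl) x,
          hno _ (mem_imagePoints.mpr ⟨x, rfl⟩), h.fixed (fun _ => rfl) hy']
      have hij := congrArg a (congrFun this i)
      simp only [hs i hi, hs j hj] at hij
      exact hji hij.symm
    have hle : ∑ w ∈ {x, y}, (hitClass φ w).card ≤
        ∑ w ∈ imagePoints φ (fun _ => s i), (hitClass φ w).card :=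
      Finset.sum_le_sum_of_subset (by
        intro w hw; rcases Finset.mem_insert.mp hw with rfl | hw
        · exact hx
        · rwa [Finset.mem_singleton.mp hw])
    rw [Finset.sum_pair hxy] at hle
    have := hitClass_card_pos (imagePoints_subset_hit _ hx)
    omega
  · have hsub : ({i, j} : Finset Z) ⊆ R := by
      intro w hw; rcases Finset.mem_insert.mp hw with rfl | hw
      · exact hi
      · rwa [Finset.mem_singleton.mp hw]
    have hA2 := hA {i, j} hsub (Finset.mem_insert_self _ _)
    have hsum2 : ∑ w ∈ R \ {i, j}, t w + 4 = Fintype.card Z := by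
      rw [← htR, ← Finset.sum_sdiff hsub, Finset.sum_pair (Ne.symm hji), hti2, htj]
    have hmem : ∀ w ∈ ({i, j} : Finset Z), imagePoints φ (fun _ => s w) ⊆
        imagePoints φ (retraction s i {i, j}) := fun w hw =>
      h.imagePoints_subset fun _ => by rw [hs w (hsub hw), retraction_of_mem hw]
    have hle : ∑ w ∈ {y, y'}, (hitClass φ w).card ≤
        ∑ w ∈ imagePoints φ (retraction s i {i, j}), (hitClass φ w).card :=
      Finset.sum_le_sum_of_subset (by
        intro w hw; rcases Finset.mem_insert.mp hw with rfl | hw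
        · exact hmem i (by simp) hy
        · rw [Finset.mem_singleton.mp hw]; exact hmem j (by simp) hy')
    rw [Finset.sum_pair hyy] at hle
    -- Here 10 = 2 + 2 + k: both fibres plus the k extra points.
    have := ten_le_add_of_pow_le h7 hpow hpow'
    omega

end Representation

/-! ### Upper bound: an action on 2n - r points -/

section Embedding

variable {Z : Type} (a : Z → Z)

/-- The action of the variant on the disjoint union of `Z` and the points missed by `a`. -/
def extend (f : Z → Z) :
    Z ⊕ {x : Z // x ∉ Set.range a} → Z ⊕ {x : Z // x ∉ Set.range a}
  | .inl z => .inl (f (a z))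
  | .inr x => .inl (f x)

theorem extend_injective : Function.Injective (extend a) := by
  intro f g hfg
  funext x
  by_cases hx : x ∈ Set.range a
  · obtain ⟨z, rfl⟩ := hx
    exact Sum.inl_injective (congrFun hfg (.inl z))
  · exact Sum.inl_injective (congrFun hfg (.inr ⟨x, hx⟩))

theorem semigroupEmbeds_extend (a : FullTransformation Z) :
    SemigroupEmbeds (SemigroupVariant a)
      (FullTransformation (Z ⊕ {x : Z // x ∉ Set.range a})) := by
  refine ⟨⟨fun f => extend a f, fun f g => ?_⟩, fun f g h => extend_injective a h⟩
  funext y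
  rcases y with z | x <;> rfl

end Embedding

end FullTransformation

theorem mainTheorem1 (n : ℕ) (hn : 1 ≤ n) (a : FullTransformation (Fin n)) (r : ℕ)
    (hr : FullTransformation.rank a = r) (hrn : (n : ℤ) - 6 ≤ (r : ℤ)) :
    minTransformationDegree (SemigroupVariant a) = ((2 * n - r : ℕ) : Cardinal) := by
  classical
  have : Nonempty (Fin n) := ⟨⟨0, hn⟩⟩
  let b : Fin n → Fin n := a
  have hR : ∀ _ : DecidableEq (Fin n), (Finset.univ.image b).card = r := by
    intro _
    rw [← hr, ← Set.ncard_coe_finset, Finset.coe_image, Finset.coe_univ, Set.image_univ]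
    rfl
  apply le_antisymm
  · refine (minTransformationDegree_isLeast _).2
      ⟨Fin n ⊕ {x : Fin n // x ∉ Set.range b}, inferInstance, FullTransformation.semigroupEmbeds_extend a, ?_⟩
    rw [Cardinal.mk_fintype, Fintype.card_sum, Fintype.card_fin, Fintype.card_subtype_compl,
      Fintype.card_fin]
    have h1 : Fintype.card {x // x ∈ Set.range b} = r := by
      rw [← hR inferInstance, Fintype.card_subtype]
      congr 1
      ext x; simp
    have h2 : r ≤ n := by
      rw [← hR inferInstance]; exact (Finset.card_le_univ _).trans (Fintype.card_fin n).le
    rw [h1]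
    congr 1
    omega
  · refine le_csInf (transformationDegrees_nonempty _) ?_
    rintro c ⟨Y, hY, ⟨φ, hφ⟩, rfl⟩
    -- Degrees are cardinals, so infinite Y must be dismissed separately.
    rcases lt_or_ge (Cardinal.mk Y) Cardinal.aleph0 with hfin | hinf
    · have : Finite Y := Cardinal.lt_aleph0_iff_finite.mp hfin
      have : Fintype Y := Fintype.ofFinite Y
      have key := FullTransformation.IsVariantRep.two_mul_card_sub_le (Z := Fin n) (Y := Y) (a := b)
        (φ := fun f => φ f) (fun f g y => congrFun (φ.map_mul f g) y) hφ
        (by rw [hR, Fintype.card_fin]; omega)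
      rw [hR, Fintype.card_fin] at key
      rw [Cardinal.mk_fintype]
      exact_mod_cast (by omega : 2 * n - r ≤ Fintype.card Y)
    · exact (Cardinal.natCast_lt_aleph0.le).trans hinf
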